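/- A *Heyting residuated lattice* is an algebra $\mathbf A=\langle A,\wedge,\vee,\cdot,\backslash,/,\to,1\rangle$ such that $\langle A,\wedge,\vee\rangle$ is a lattice, $\langle A,\cdot,1\rangle$ is a monoid, $1$ is the greatest element of $A$, and for all $x,y,z\in A$ $$x\cdot y\le z\iff y\le x\backslash z\iff x\le z/y,\qquad\text{and}\qquad x\wedge y\le z\iff x\le y\to z .$$ (A least element is not required to exist, and no constant for it is in the language.) Let $\mathcal{HRL}$ be the class (a variety) of all Heyting residuated lattices. A *finite partial subalgebra* $\mathbf B$ of $\mathbf A$ is a nonempty finite subset $B\subseteq A$ together with, for each of the seven operation symbols $f$, say of arity $n$, a partial operation $f^{\mathbf B}$ from a subset of $B^n$ to $B$, such that whenever $f^{\mathbf B}(b_1,\dots,b_n)$ is defined, it equals $f^{\mathbf A}(b_1,\dots,b_n)$. An *embedding* of $\mathbf B$ into an algebra $\mathbf C$ of the same language is an injective map $\varphi\colon B\to C$ such that $\varphi(f^{\mathbf B}(b_1,\dots,b_n))=f^{\mathbf C}(\varphi(b_1),\dots,\varphi(b_n))$ whenever $f^{\mathbf B}(b_1,\dots,b_n)$ is defined.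 **Theorem.** The variety $\mathcal{HRL}$ of Heyting residuated lattices has the finite embeddability property: for every $\mathbf A\in\mathcal{HRL}$, every finite partial subalgebra of $\mathbf A$ can be embedded into a finite algebra belonging to $\mathcal{HRL}$. -/

import Mathlib

universe u

namespace UA

/-- An algebraic language: a nonempty set of operation symbols, each with a finite arity. -/
structure AlgLanguage where
  Symb : Type
  symb_nonempty : Nonempty Symb
  arity : Symb → ℕ

/-- A partial algebra on the nonempty set `P`: every operation symbol `f` is interpreted by a
partial operation `P ^ (arity f) ⇀ P`. -/
structure PartialAlgebra (L : AlgLanguage) (P : Type u) where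
  nonempty : Nonempty P
  op : (f : L.Symb) → (Fin (L.arity f) → P) →. P

/-- A (total) algebra on the nonempty set `A`. -/
structure TotalAlgebra (L : AlgLanguage) (A : Type u) where
  nonempty : Nonempty A
  op : (f : L.Symb) → (Fin (L.arity f) → A) → A

/-- A total algebra, seen as a partial algebra all of whose operations are everywhere defined. -/
def TotalAlgebra.toPartial {L : AlgLanguage} {A : Type u} (𝓐 : TotalAlgebra L A) :
    PartialAlgebra L A where
  nonempty := 𝓐.nonempty
  op f := ((𝓐.op f : (Fin (L.arity f) → A) → A) : (Fin (L.arity f) → A) →. A)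

/-- `φ` is a homomorphism of partial algebras: whenever `f(p₁, …, pₙ)` is defined in the source
with value `r`, then `f(φ p₁, …, φ pₙ)` is defined in the target with value `φ r`. -/
def IsHom {L : AlgLanguage} {P Q : Type u} (𝓟 : PartialAlgebra L P) (𝓠 : PartialAlgebra L Q)
    (φ : P → Q) : Prop :=
  ∀ (f : L.Symb) (p : Fin (L.arity f) → P), ∀ r ∈ 𝓟.op f p, φ r ∈ 𝓠.op f (fun i => φ (p i))

/-- An embedding of partial algebras is an injective homomorphism. -/
def IsEmb {L : AlgLanguage} {P Q : Type u} (𝓟 : PartialAlgebra L P) (𝓠 : PartialAlgebra L Q)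
    (φ : P → Q) : Prop :=
  Function.Injective φ ∧ IsHom 𝓟 𝓠 φ

/-- The partial algebra `𝓑` on the subset `B` of `Q` is a partial subalgebra of `𝓠`: the
inclusion map is a homomorphism. -/
def IsPartialSubalgebra {L : AlgLanguage} {Q : Type u} (𝓠 : PartialAlgebra L Q) {B : Set Q}
    (𝓑 : PartialAlgebra L B) : Prop :=
  IsHom 𝓑 𝓠 (Subtype.val : B → Q)

/-- A class of algebras in the language `L`. -/
abbrev AlgebraClass (L : AlgLanguage) : Type (u + 1) :=
  (A : Type u) → TotalAlgebra L A → Prop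

/-- The algebra `𝓐` has the finite embeddability property in the class `K`: every finite partial
subalgebra of `𝓐` can be embedded into a finite algebra of `K`. -/
def HasFEPIn {L : AlgLanguage} (K : AlgebraClass.{u} L) {A : Type u} (𝓐 : TotalAlgebra L A) :
    Prop :=
  ∀ (B : Set A) (𝓑 : PartialAlgebra L B), B.Finite → IsPartialSubalgebra 𝓐.toPartial 𝓑 →
    ∃ (C : Type u) (𝓒 : TotalAlgebra L C), K C 𝓒 ∧ Finite C ∧
      ∃ φ : B → C, IsEmb 𝓑 𝓒.toPartial φ

/-- The class `K` has the finite embeddability property: each of its members has it in `K`. -/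
def HasFEP {L : AlgLanguage} (K : AlgebraClass.{u} L) : Prop :=
  ∀ (A : Type u) (𝓐 : TotalAlgebra L A), K A 𝓐 → HasFEPIn K 𝓐

/-- The operation symbols `∧`, `∨`, `·`, `\`, `/`, `→`, `1`. -/
inductive HRLSymb : Type
  | inf | sup | mul | ldiv | rdiv | imp | one

/-- The language with the binary symbols `∧`, `∨`, `·`, `\`, `/`, `→` and the constant `1`. -/
def hrlLanguage : AlgLanguage where
  Symb := HRLSymb
  symb_nonempty := ⟨HRLSymb.one⟩
  arity
    | .inf | .sup | .mul | .ldiv | .rdiv | .imp => 2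
    | .one => 0

/-- A Heyting residuated lattice: a lattice with a Heyting implication `⇨` (residual of the meet),
carrying also a monoid structure whose identity is the top element (integrality) and whose
multiplication has the residuals `ldiv x z = x \ z` and `rdiv z y = z / y`.
The multiplication preserves the order in both coordinates; this follows from the residuation
laws, see `mul_le_mul_of_hrl`.  No constant for a least element belongs to the language,
and none is required to exist. -/
class HeytingResiduatedLattice (A : Type u) extends GeneralizedHeytingAlgebra A, Monoid A where
  ldiv : A → A → A
  rdiv : A → A → A
  mul_le_iff_le_ldiv : ∀ x y z : A, x * y ≤ z ↔ y ≤ ldiv x z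
  mul_le_iff_le_rdiv : ∀ x y z : A, x * y ≤ z ↔ x ≤ rdiv z y
  one_eq_top : (1 : A) = ⊤

theorem mul_le_mul_of_hrl {A : Type u} [HeytingResiduatedLattice A] {a b c d : A}
    (hab : a ≤ b) (hcd : c ≤ d) : a * c ≤ b * d :=
  le_trans
    ((HeytingResiduatedLattice.mul_le_iff_le_rdiv a c _).2
      (hab.trans ((HeytingResiduatedLattice.mul_le_iff_le_rdiv b c _).1 le_rfl)))
    ((HeytingResiduatedLattice.mul_le_iff_le_ldiv b c _).2
      (hcd.trans ((HeytingResiduatedLattice.mul_le_iff_le_ldiv b d _).1 le_rfl)))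

/-- The algebra `⟨A, ∧, ∨, ·, \, /, →, 1⟩` of a Heyting residuated lattice. -/
def HeytingResiduatedLattice.toAlgebra (A : Type u) [HeytingResiduatedLattice A] :
    TotalAlgebra hrlLanguage A where
  nonempty := ⟨1⟩
  op
    | .inf => fun a : Fin 2 → A => a 0 ⊓ a 1
    | .sup => fun a : Fin 2 → A => a 0 ⊔ a 1
    | .mul => fun a : Fin 2 → A => a 0 * a 1
    | .ldiv => fun a : Fin 2 → A => HeytingResiduatedLattice.ldiv (a 0) (a 1)
    | .rdiv => fun a : Fin 2 → A => HeytingResiduatedLattice.rdiv (a 0) (a 1)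
    | .imp => fun a : Fin 2 → A => a 0 ⇨ a 1
    | .one => fun _ => 1

/-- The class of all algebras `⟨A, ∧, ∨, ·, \, /, →, 1⟩` that are Heyting residuated lattices. -/
def HRL : AlgebraClass.{u} hrlLanguage := fun A 𝓐 =>
  ∃ _ : HeytingResiduatedLattice A, 𝓐 = HeytingResiduatedLattice.toAlgebra A

end UA

/-!
Let `B` be a finite subset of a Heyting residuated lattice `A`, and put `S = B ∪ {1}`. Let `W` be the
closure of `S` under `·` and `∧`, and let `R` be the closure of `S` under the residual maps `w \ _`,
`_ / w` and `w → _` with `w ∈ W`. The relation `≤` between `W` and `R` is a formal context, and its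
concepts ("cuts") form a complete lattice in which `c ≤ d` means inclusion of extents. Because `R`
is closed under the residuals by `W`, the sets `{y ∈ W | ∀ x ∈ X, x · y ∈ Z}`, and their analogues
for `/` and `→`, are extents whenever `Z` is. Hence the cuts form a Heyting residuated lattice
(`ResiduatedPair.cutHRL`). Meet is among the generating operations, so the same argument
gives the Heyting implication: extents are lower sets of `W`, and on lower sets the
intersection is generated by the elements `x ∧ y`. The map sending `b` to the trace on `W` of the
principal ideal of `b` is injective on `B` and preserves each operation of `A` whose value on given
elements of `B` lies in `B`.

The lattice of cuts is finite because there are only finitely many traces `W ∩ Iic r`, `r ∈ R`, of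
which every extent is an intersection. For this, by integrality `x · y` and `x ∧ y` lie below both
`x` and `y`, so a minimal bad sequence argument on terms, as in Higman's and Kruskal's theorems,
shows that `W` is well-quasi-ordered by `≥`
(`MulInfTerm.partiallyWellOrderedOn_range_eval`). Consequently the residual maps by elements of `W`
are well-quasi-ordered pointwise; they are monotone and inflationary, so Higman's lemma for lists
makes `R` well-quasi-ordered by `≤` (`isPWO_residualClosure`). Infinitely many distinct traces would
give a strictly increasing sequence of traces, and then a sequence of witnesses which is bad
for `≥` on `W` (`finite_image_inter_Iic`).
-/

open Set Order
open scoped Pointwise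

namespace UA

/-! ### Well-quasi-orders and finiteness of concept lattices -/

section WellQuasiOrder

variable {α : Type*}

/-- Nash-Williams' minimal bad sequence argument for a type whose elements have "children" of
smaller rank, each of them `r`-below its parent. If the elements all of whose children lie in a given
partially well-ordered set always form a partially well-ordered set, then so does the whole
type. -/
theorem partiallyWellOrderedOn_univ_of_children {r : α → α → Prop} [IsPreorder α r]
    (rk : α → ℕ) (children : α → Set α)
    (hrk : ∀ y, ∀ x ∈ children y, rk x < rk y) (hr : ∀ y, ∀ x ∈ children y, r x y)
    (H : ∀ s : Set α, s.PartiallyWellOrderedOn r →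
      {y | children y ⊆ s}.PartiallyWellOrderedOn r) :
    (univ : Set α).PartiallyWellOrderedOn r := by
  rw [PartiallyWellOrderedOn.iff_not_exists_isMinBadSeq rk]
  rintro ⟨f, hf, hmin⟩
  suffices hs : (⋃ n, children (f n)).PartiallyWellOrderedOn r by
    obtain ⟨m, n, hmn, h⟩ := (H _ hs).exists_lt (f := f)
      fun n ↦ subset_iUnion (fun n ↦ children (f n)) n
    exact hf.2 m n hmn h
  rw [PartiallyWellOrderedOn.iff_forall_not_isBadSeq]
  rintro h ⟨hmem, hbad⟩
  simp only [mem_iUnion] at hmem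
  choose k hk using hmem
  -- Restart the bad sequence `h` of children at the index `i` where the parent comes earliest.
  obtain ⟨i, hi⟩ : ∃ i, ∀ j, k i ≤ k j := by
    obtain ⟨_, ⟨i, rfl⟩, hi⟩ := wellFounded_lt.has_min (range k) (range_nonempty k)
    exact ⟨i, fun j ↦ not_lt.1 (hi _ ⟨j, rfl⟩)⟩
  refine hmin (k i) (fun m ↦ if m < k i then f m else h (i + (m - k i)))
    (fun m hm ↦ (if_pos hm).symm) ?_ ⟨fun _ ↦ mem_univ _, fun m n hmn ↦ ?_⟩
  · simpa using hrk _ _ (hk i)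
  · by_cases hn : n < k i
    · simpa only [if_pos hn, if_pos (hmn.trans hn)] using hf.2 m n hmn
    · by_cases hm : m < k i
      · simp only [if_pos hm, if_neg hn]
        exact fun hmh ↦ hf.2 m _ (hm.trans_le (hi _)) (_root_.trans hmh (hr _ _ (hk _)))
      · simp only [if_neg hm, if_neg hn]
        exact hbad _ _ (by omega)

/-- If `s` is well-quasi-ordered by `≤` and `t` by `≥`, the principal ideals of elements of `s` have
only finitely many traces on `t`. -/
theorem finite_image_inter_Iic [Preorder α] {s t : Set α} (hs : s.IsPWO)
    (ht : t.PartiallyWellOrderedOn (· ≥ ·)) : ((fun r ↦ t ∩ Iic r) '' s).Finite := by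
  by_contra hinf
  have hinf : ((fun r ↦ t ∩ Iic r) '' s).Infinite := hinf
  choose a has ha using fun n ↦ (hinf.natEmbedding _ n).2
  have hinj : ∀ m n, t ∩ Iic (a m) = t ∩ Iic (a n) → m = n := fun m n h ↦
    (hinf.natEmbedding _).injective (Subtype.ext ((ha m).symm.trans (h.trans (ha n))))
  obtain ⟨g, hg⟩ := PartiallyWellOrderedOn.exists_monotone_subseq hs has
  -- Along `a ∘ g` the traces grow strictly; `b n` witnesses the step from `n` to `n + 1`.
  have hex : ∀ n, ∃ b ∈ t, b ≤ a (g (n + 1)) ∧ ¬ b ≤ a (g n) := by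
    intro n
    by_contra! hcon
    have h := hinj (g (n + 1)) (g n) (Subset.antisymm (fun b hb ↦ ⟨hb.1, hcon b hb.1 hb.2⟩)
      fun b hb ↦ ⟨hb.1, le_trans (mem_Iic.1 hb.2) (hg _ _ n.le_succ)⟩)
    exact n.succ_ne_self (g.injective h)
  choose b hbt hb hb' using hex
  obtain ⟨m, n, hmn, hle⟩ := ht.exists_lt hbt
  exact hb' n (le_trans hle ((hb m).trans (hg _ _ hmn)))

/-- A formal context with finitely many distinct columns has finitely many concepts, since every
extent is an intersection of columns. -/
theorem finite_concept {α β : Type*} {r : α → β → Prop}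
    (h : (range fun b ↦ {a | r a b}).Finite) : Finite (Concept α β r) := by
  have := h.to_subtype
  refine Finite.of_injective
    (fun c : Concept α β r ↦ {e : range fun b ↦ {a | r a b} | c.extent ⊆ e}) fun c d hcd ↦ ?_
  have key : ∀ c d : Concept α β r, {e : range fun b ↦ {a | r a b} | c.extent ⊆ e} =
      {e : range fun b ↦ {a | r a b} | d.extent ⊆ e} → c ≤ d := by
    intro c d hcd
    rw [← Concept.extent_subset_extent_iff]
    intro x hx
    rw [← d.lowerPolar_intent]
    intro b hb
    have hd : (⟨_, b, rfl⟩ : range fun b ↦ {a | r a b}) ∈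
        {e : range fun b ↦ {a | r a b} | d.extent ⊆ e} :=
      fun y hy ↦ d.rel_extent_intent hy hb
    rw [← hcd] at hd
    exact hd hx
  exact le_antisymm (key c d hcd) (key d c hcd.symm)

end WellQuasiOrder

/-! ### The Heyting residuated lattice of cuts -/

/-- If the attributes are closed under residuals `g x` of the maps `f x`, then extents are closed
under residuation by arbitrary sets of objects. -/
theorem isExtent_residual {α β : Type*} {r : α → β → Prop} {f : α → α → α} {g : α → β → β}
    (h : ∀ x y b, r (f x y) b ↔ r y (g x b)) (s : Set α) (c : Concept α β r) :
    IsExtent r {y | ∀ x ∈ s, f x y ∈ c.extent} := by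
  refine ⟨image2 g s c.intent, ?_⟩
  ext y
  simp only [← c.lowerPolar_intent, mem_lowerPolar_iff, forall_mem_image2, mem_ofPred_eq, h]

open HeytingResiduatedLattice

/-- A submonoid `lower` of `A` closed under meets, with a set `upper` closed under the residuals by
elements of `lower`. The two sets serve as the objects and the attributes of a formal context. -/
structure ResiduatedPair (A : Type u) [HeytingResiduatedLattice A] where
  lower : Submonoid A
  upper : Set A
  inf_mem : ∀ x ∈ lower, ∀ y ∈ lower, x ⊓ y ∈ lower
  ldiv_mem : ∀ x ∈ lower, ∀ r ∈ upper, ldiv x r ∈ upper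
  rdiv_mem : ∀ x ∈ lower, ∀ r ∈ upper, rdiv r x ∈ upper
  himp_mem : ∀ x ∈ lower, ∀ r ∈ upper, x ⇨ r ∈ upper

namespace ResiduatedPair

variable {A : Type u} [HeytingResiduatedLattice A] (P : ResiduatedPair A)

/-- The incidence relation of the formal context: the order of `A`. -/
def Rel (x : P.lower) (r : P.upper) : Prop := (x : A) ≤ r

/-- The cuts of a residuated pair: the formal concepts of the order relation between its lower and
its upper set. -/
abbrev Cut : Type u := Concept P.lower P.upper P.Rel

variable {P}

/-- The meet of `A` on the lower set. -/
def meet (x y : P.lower) : P.lower := ⟨x ⊓ y, P.inf_mem _ x.2 _ y.2⟩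

theorem mem_extent_of_le {c : P.Cut} {x y : P.lower} (hxy : (x : A) ≤ y) (hy : y ∈ c.extent) :
    x ∈ c.extent := by
  rw [← c.lowerPolar_intent]
  exact fun r hr ↦ hxy.trans (c.rel_extent_intent hy hr)

/-- The product of two cuts: the cut generated by the elementwise product of the extents. -/
def cutMul (c d : P.Cut) : P.Cut := Concept.ofObjects P.Rel (c.extent * d.extent)

/-- The left residual `c \ d` of cuts. -/
def cutLdiv (c d : P.Cut) : P.Cut :=
  Concept.ofIsExtent P.Rel {y | ∀ x ∈ c.extent, x * y ∈ d.extent} <|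
    isExtent_residual (g := fun x r ↦ ⟨ldiv x r, P.ldiv_mem _ x.2 _ r.2⟩)
      (fun _ _ _ ↦ mul_le_iff_le_ldiv _ _ _) _ _

/-- The right residual `d / c` of cuts. -/
def cutRdiv (d c : P.Cut) : P.Cut :=
  Concept.ofIsExtent P.Rel {x | ∀ y ∈ c.extent, x * y ∈ d.extent} <|
    isExtent_residual (f := fun y x ↦ x * y) (g := fun y r ↦ ⟨rdiv r y, P.rdiv_mem _ y.2 _ r.2⟩)
      (fun _ _ _ ↦ mul_le_iff_le_rdiv _ _ _) _ _

/-- The Heyting implication of cuts, defined as the residual of the elementwise meet. It is the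
residual of the lattice meet because extents are lower sets, see `le_cutHimp_iff`. -/
def cutHimp (c d : P.Cut) : P.Cut :=
  Concept.ofIsExtent P.Rel {y | ∀ x ∈ c.extent, meet x y ∈ d.extent} <|
    isExtent_residual (g := fun x r ↦ ⟨x ⇨ r, P.himp_mem _ x.2 _ r.2⟩)
      (fun _ _ _ ↦ le_himp_iff'.symm) _ _

theorem cutMul_le_iff {c d e : P.Cut} :
    cutMul c d ≤ e ↔ ∀ x ∈ c.extent, ∀ y ∈ d.extent, x * y ∈ e.extent := by
  rw [cutMul, Concept.ofObjects_le_iff, Set.mul_subset_iff]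

theorem cutMul_le_iff_le_cutLdiv (c d e : P.Cut) : cutMul c d ≤ e ↔ d ≤ cutLdiv c e := by
  rw [cutMul_le_iff, ← Concept.extent_subset_extent_iff]
  exact ⟨fun h y hy x hx ↦ h x hx y hy, fun h x hx y hy ↦ h hy x hx⟩

theorem cutMul_le_iff_le_cutRdiv (c d e : P.Cut) : cutMul c d ≤ e ↔ c ≤ cutRdiv e d := by
  rw [cutMul_le_iff, ← Concept.extent_subset_extent_iff]
  rfl

theorem le_cutHimp_iff (c d e : P.Cut) : c ≤ cutHimp d e ↔ c ⊓ d ≤ e := by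
  rw [← Concept.extent_subset_extent_iff, ← Concept.extent_subset_extent_iff]
  constructor
  -- The extents are lower sets, and `x = x ∧ x`.
  · rintro h x ⟨hxc, hxd⟩
    exact mem_extent_of_le (le_inf le_rfl le_rfl) (h hxc x hxd)
  · exact fun h y hy x hx ↦ h ⟨mem_extent_of_le inf_le_right hy, mem_extent_of_le inf_le_left hx⟩

theorem cutMul_assoc (c d e : P.Cut) : cutMul (cutMul c d) e = cutMul c (cutMul d e) := by
  refine eq_of_forall_ge_iff fun v ↦ ?_
  rw [cutMul_le_iff_le_cutRdiv, cutMul_le_iff, cutMul_le_iff_le_cutLdiv c, cutMul_le_iff]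
  constructor
  · intro h y hy z hz x hx
    rw [← mul_assoc]
    exact h x hx y hy z hz
  · intro h x hx y hy z hz
    rw [mul_assoc]
    exact h y hy z hz x hx

theorem le_one (x : A) : x ≤ 1 := one_eq_top (A := A) ▸ le_top

theorem mul_le_left (x y : A) : x * y ≤ x := by
  simpa using mul_le_mul_of_hrl (le_refl x) (le_one y)

theorem mul_le_right (x y : A) : x * y ≤ y := by
  simpa using mul_le_mul_of_hrl (le_one x) (le_refl y)

theorem top_cutMul (c : P.Cut) : cutMul ⊤ c = c := by
  refine eq_of_forall_ge_iff fun v ↦ ?_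
  rw [cutMul_le_iff, ← Concept.extent_subset_extent_iff]
  refine ⟨fun h x hx ↦ ?_, fun h x _ y hy ↦ mem_extent_of_le (mul_le_right _ _) (h hy)⟩
  simpa using h 1 trivial x hx

theorem cutMul_top (c : P.Cut) : cutMul c ⊤ = c := by
  refine eq_of_forall_ge_iff fun v ↦ ?_
  rw [cutMul_le_iff, ← Concept.extent_subset_extent_iff]
  refine ⟨fun h x hx ↦ ?_, fun h x hx y _ ↦ mem_extent_of_le (mul_le_left _ _) (h hx)⟩
  simpa using h x hx 1 trivial

variable (P) in
/-- The Heyting residuated lattice of cuts. Its unit is the top cut, whose extent is all of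
`P.lower`. -/
@[reducible]
def cutHRL : HeytingResiduatedLattice P.Cut where
  __ := (inferInstance : Lattice P.Cut)
  top := ⊤
  le_top _ := le_top
  himp := cutHimp
  le_himp_iff := le_cutHimp_iff
  mul := cutMul
  mul_assoc := cutMul_assoc
  one := ⊤
  one_mul := top_cutMul
  mul_one := cutMul_top
  ldiv := cutLdiv
  rdiv := cutRdiv
  mul_le_iff_le_ldiv := cutMul_le_iff_le_cutLdiv
  mul_le_iff_le_rdiv := cutMul_le_iff_le_cutRdiv
  one_eq_top := rfl

/-! ### Principal cuts -/

/-- The cut whose extent consists of the elements of `P.lower` below `r`. -/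
def principal (r : P.upper) : P.Cut := Concept.ofAttribute P.Rel r

theorem mem_extent_principal {r : P.upper} {x : P.lower} :
    x ∈ (principal r).extent ↔ (x : A) ≤ r := by
  simp [principal, Rel]

theorem principal_le_iff {r : P.upper} (hr : (r : A) ∈ P.lower) {c : P.Cut} :
    principal r ≤ c ↔ ⟨r, hr⟩ ∈ c.extent := by
  rw [← Concept.extent_subset_extent_iff]
  exact ⟨fun h ↦ h (mem_extent_principal.2 le_rfl),
    fun h x hx ↦ mem_extent_of_le (mem_extent_principal.1 hx) h⟩

theorem principal_injOn {r s : P.upper} (hr : (r : A) ∈ P.lower) (hs : (s : A) ∈ P.lower)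
    (h : principal r = principal s) : r = s :=
  Subtype.ext <| le_antisymm
    (mem_extent_principal.1 ((principal_le_iff hr).1 h.le))
    (mem_extent_principal.1 ((principal_le_iff hs).1 h.ge))

theorem principal_inf {r s t : P.upper} (h : (r : A) ⊓ s = t) :
    principal t = principal r ⊓ principal s := by
  ext x
  simp [mem_extent_principal, ← h]

/-- Joins need no distributivity argument: `r ⊔ s ≤ b` holds iff `r ≤ b` and `s ≤ b`, so the upper
polars agree. -/
theorem principal_sup {r s t : P.upper} (hr : (r : A) ∈ P.lower) (hs : (s : A) ∈ P.lower)
    (ht : (t : A) ∈ P.lower) (h : (r : A) ⊔ s = t) :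
    principal t = principal r ⊔ principal s := by
  refine eq_of_forall_ge_iff fun c ↦ ?_
  rw [sup_le_iff, principal_le_iff hr, principal_le_iff hs, principal_le_iff ht]
  simp only [← c.lowerPolar_intent, mem_lowerPolar_iff, Rel, ← h, sup_le_iff]
  exact ⟨fun h ↦ ⟨fun _ hb ↦ (h hb).1, fun _ hb ↦ (h hb).2⟩, fun h _ hb ↦ ⟨h.1 hb, h.2 hb⟩⟩

theorem principal_mul {r s t : P.upper} (hr : (r : A) ∈ P.lower) (hs : (s : A) ∈ P.lower)
    (ht : (t : A) ∈ P.lower) (h : (r : A) * s = t) :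
    principal t = cutMul (principal r) (principal s) := by
  refine eq_of_forall_ge_iff fun c ↦ ?_
  rw [principal_le_iff ht, cutMul_le_iff]
  constructor
  · intro hc x hx y hy
    refine mem_extent_of_le ?_ hc
    exact (mul_le_mul_of_hrl (mem_extent_principal.1 hx) (mem_extent_principal.1 hy)).trans h.le
  · intro hc
    exact mem_extent_of_le h.ge
      (hc ⟨r, hr⟩ (mem_extent_principal.2 le_rfl) ⟨s, hs⟩ (mem_extent_principal.2 le_rfl))

theorem principal_ldiv {r s t : P.upper} (hr : (r : A) ∈ P.lower) (h : ldiv (r : A) s = t) :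
    principal t = cutLdiv (principal r) (principal s) := by
  ext y
  rw [mem_extent_principal, ← h, ← mul_le_iff_le_ldiv]
  constructor
  · exact fun hy x hx ↦ mem_extent_principal.2
      ((mul_le_mul_of_hrl (mem_extent_principal.1 hx) le_rfl).trans hy)
  · exact fun hy ↦ mem_extent_principal.1 (hy ⟨r, hr⟩ (mem_extent_principal.2 le_rfl))

theorem principal_rdiv {r s t : P.upper} (hs : (s : A) ∈ P.lower) (h : rdiv (r : A) s = t) :
    principal t = cutRdiv (principal r) (principal s) := by
  ext x
  rw [mem_extent_principal, ← h, ← mul_le_iff_le_rdiv]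
  constructor
  · exact fun hx y hy ↦ mem_extent_principal.2
      ((mul_le_mul_of_hrl le_rfl (mem_extent_principal.1 hy)).trans hx)
  · exact fun hx ↦ mem_extent_principal.1 (hx ⟨s, hs⟩ (mem_extent_principal.2 le_rfl))

theorem principal_himp {r s t : P.upper} (hr : (r : A) ∈ P.lower) (h : (r : A) ⇨ s = t) :
    principal t = cutHimp (principal r) (principal s) := by
  ext y
  rw [mem_extent_principal, ← h, le_himp_iff']
  constructor
  · exact fun hy x hx ↦ mem_extent_principal.2
      ((inf_le_inf_right _ (mem_extent_principal.1 hx)).trans hy)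
  · exact fun hy ↦ mem_extent_principal.1 (hy ⟨r, hr⟩ (mem_extent_principal.2 le_rfl))

theorem principal_one {r : P.upper} (h : (r : A) = 1) : principal r = ⊤ := by
  ext x
  simp [mem_extent_principal, h, le_one]

variable (P) in
theorem finite_cut (hl : (P.lower : Set A).PartiallyWellOrderedOn (· ≥ ·)) (hu : P.upper.IsPWO) :
    Finite P.Cut := by
  refine finite_concept (((finite_image_inter_Iic hu hl).image
    fun s : Set A ↦ ((↑) : P.lower → A) ⁻¹' s).subset ?_)
  rintro _ ⟨r, rfl⟩
  refine ⟨_, ⟨r, r.2, rfl⟩, ?_⟩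
  ext x
  simp [Rel]

end ResiduatedPair

open ResiduatedPair

/-! ### The closure under multiplication and meet -/

/-- Terms in the operation symbols `·` and `∧` with leaves in `α`. -/
inductive MulInfTerm (α : Type u) : Type u
  | leaf (a : α) : MulInfTerm α
  | mul (s t : MulInfTerm α) : MulInfTerm α
  | inf (s t : MulInfTerm α) : MulInfTerm α

namespace MulInfTerm

variable {A : Type u} [HeytingResiduatedLattice A] {S : Set A}

/-- The number of operation symbols in a term. -/
def size {α : Type u} : MulInfTerm α → ℕ
  | leaf _ => 0
  | mul s t => s.size + t.size + 1
  | inf s t => s.size + t.size + 1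

/-- The immediate subterms of a term. -/
def children {α : Type u} : MulInfTerm α → Set (MulInfTerm α)
  | leaf _ => ∅
  | mul s t => {s, t}
  | inf s t => {s, t}

/-- The value of a term with leaves in `S ⊆ A`. -/
def eval : MulInfTerm S → A
  | leaf a => a
  | mul s t => s.eval * t.eval
  | inf s t => s.eval ⊓ t.eval

theorem size_lt_of_mem_children {α : Type u} (t : MulInfTerm α) :
    ∀ s ∈ t.children, s.size < t.size := by
  cases t <;> simp only [children, size, mem_empty_iff_false, mem_insert_iff, mem_singleton_iff,
    forall_eq_or_imp, forall_eq, false_imp_iff, implies_true] <;> omega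

theorem eval_le_of_mem_children (t : MulInfTerm S) : ∀ s ∈ t.children, t.eval ≤ s.eval := by
  cases t <;> simp [children, eval, mul_le_left, mul_le_right]

/-- The closure of a finite set under `·` and `∧` is well-quasi-ordered by `≥`. This rests on
integrality: the value of a term lies below the values of its subterms. -/
theorem partiallyWellOrderedOn_range_eval (hS : S.Finite) :
    (range (eval : MulInfTerm S → A)).PartiallyWellOrderedOn (· ≥ ·) := by
  have := hS.to_subtype
  let r : MulInfTerm S → MulInfTerm S → Prop := fun s t ↦ s.eval ≥ t.eval
  have : IsPreorder (MulInfTerm S) r :=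
    { refl := fun _ ↦ le_refl (α := A) _, trans := fun _ _ _ h h' ↦ ge_trans h h' }
  rw [← image_univ]
  refine PartiallyWellOrderedOn.image_of_monotone_on (r := r) ?_ fun _ _ _ _ h ↦ h
  refine partiallyWellOrderedOn_univ_of_children size children size_lt_of_mem_children
    eval_le_of_mem_children fun P hP ↦ ?_
  have hPP := hP.prod hP
  refine (((finite_range (leaf : S → MulInfTerm S)).partiallyWellOrderedOn (r := r)).union
    ((hPP.image_of_monotone_on (r' := r) (f := fun p ↦ mul p.1 p.2) ?_).union
      (hPP.image_of_monotone_on (r' := r) (f := fun p ↦ inf p.1 p.2) ?_))).mono ?_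
  · exact fun _ _ _ _ h ↦ mul_le_mul_of_hrl h.1 h.2
  · exact fun _ _ _ _ h ↦ inf_le_inf h.1 h.2
  · rintro (a | ⟨s, t⟩ | ⟨s, t⟩) h
    · exact .inl ⟨a, rfl⟩
    · exact .inr (.inl ⟨(s, t), ⟨h (by simp [children]), h (by simp [children])⟩, rfl⟩)
    · exact .inr (.inr ⟨(s, t), ⟨h (by simp [children]), h (by simp [children])⟩, rfl⟩)

end MulInfTerm

/-! ### The closure under residuals -/

section Residuals

variable {A : Type u} [HeytingResiduatedLattice A]

/-- The maps `r ↦ w \ r`, `r ↦ r / w` and `r ↦ w → r` with `w ∈ W`. As a set of functions `A → A`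
it carries the pointwise order. -/
def residualMaps (W : Set A) : Set (A → A) :=
  (fun w r ↦ ldiv w r) '' W ∪ ((fun w r ↦ rdiv r w) '' W ∪ (fun w r ↦ w ⇨ r) '' W)

theorem ldiv_le_ldiv {a b c d : A} (hba : b ≤ a) (hcd : c ≤ d) : ldiv a c ≤ ldiv b d :=
  (mul_le_iff_le_ldiv _ _ _).1 <|
    (mul_le_mul_of_hrl hba le_rfl).trans (((mul_le_iff_le_ldiv _ _ _).2 le_rfl).trans hcd)

theorem rdiv_le_rdiv {a b c d : A} (hba : b ≤ a) (hcd : c ≤ d) : rdiv c a ≤ rdiv d b :=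
  (mul_le_iff_le_rdiv _ _ _).1 <|
    (mul_le_mul_of_hrl le_rfl hba).trans (((mul_le_iff_le_rdiv _ _ _).2 le_rfl).trans hcd)

theorem isPWO_residualMaps {W : Set A} (hW : W.PartiallyWellOrderedOn (· ≥ ·)) :
    (residualMaps W).IsPWO :=
  (hW.image_of_monotone_on fun _ _ _ _ h _ ↦ ldiv_le_ldiv h le_rfl).union
    ((hW.image_of_monotone_on fun _ _ _ _ h _ ↦ rdiv_le_rdiv h le_rfl).union
      (hW.image_of_monotone_on fun _ _ _ _ h _ ↦ himp_le_himp_right h))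

theorem monotone_of_mem_residualMaps {W : Set A} {f : A → A} (hf : f ∈ residualMaps W) :
    Monotone f := by
  rcases hf with ⟨w, _, rfl⟩ | ⟨w, _, rfl⟩ | ⟨w, _, rfl⟩
  · exact fun _ _ h ↦ ldiv_le_ldiv le_rfl h
  · exact fun _ _ h ↦ rdiv_le_rdiv le_rfl h
  · exact fun _ _ h ↦ himp_le_himp_left h

theorem le_apply_of_mem_residualMaps {W : Set A} {f : A → A} (hf : f ∈ residualMaps W) (r : A) :
    r ≤ f r := by
  rcases hf with ⟨w, _, rfl⟩ | ⟨w, _, rfl⟩ | ⟨w, _, rfl⟩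
  · exact (mul_le_iff_le_ldiv _ _ _).1 (mul_le_right _ _)
  · exact (mul_le_iff_le_rdiv _ _ _).1 (mul_le_left _ _)
  · exact le_himp

/-- The result of applying the maps in `l` to `r` successively, the head of `l` last. -/
def iterate (l : List (A → A)) (r : A) : A := l.foldr (fun f x ↦ f x) r

theorem iterate_le_iterate {W : Set A} {l l' : List (A → A)} {r r' : A}
    (hl' : ∀ f ∈ l', f ∈ residualMaps W) (hr : r ≤ r')
    (h : List.SublistForall₂ (· ≤ ·) l l') : iterate l r ≤ iterate l' r' := by
  induction h with
  | nil =>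
    rename_i l'
    induction l' with
    | nil => exact hr
    | cons f l' ih =>
      rw [List.forall_mem_cons] at hl'
      exact (ih hl'.2).trans (le_apply_of_mem_residualMaps hl'.1 _)
  | cons hfg _ ih =>
    rw [List.forall_mem_cons] at hl'
    exact (hfg _).trans (monotone_of_mem_residualMaps hl'.1 (ih hl'.2))
  | cons_right _ ih =>
    rw [List.forall_mem_cons] at hl'
    exact (ih hl'.2).trans (le_apply_of_mem_residualMaps hl'.1 _)

/-- The closure of `S` under the residual maps by elements of `W`. -/
def residualClosure (W S : Set A) : Set A :=
  (fun p : A × List (A → A) ↦ iterate p.2 p.1) '' (S ×ˢ {l | ∀ f ∈ l, f ∈ residualMaps W})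

theorem apply_mem_residualClosure {W S : Set A} {f : A → A} (hf : f ∈ residualMaps W) {r : A}
    (hr : r ∈ residualClosure W S) : f r ∈ residualClosure W S := by
  obtain ⟨⟨d, l⟩, ⟨hd, hl⟩, rfl⟩ := hr
  exact ⟨(d, f :: l), ⟨hd, List.forall_mem_cons.2 ⟨hf, hl⟩⟩, rfl⟩

theorem subset_residualClosure (W S : Set A) : S ⊆ residualClosure W S :=
  fun d hd ↦ ⟨(d, []), ⟨hd, by simp⟩, rfl⟩

/-- By Higman's lemma: inserting further residual maps into a list, or enlarging some of its maps,
increases the value of `iterate`. -/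
theorem isPWO_residualClosure {W S : Set A} (hW : W.PartiallyWellOrderedOn (· ≥ ·))
    (hS : S.Finite) : (residualClosure W S).IsPWO :=
  (PartiallyWellOrderedOn.prod (hS.partiallyWellOrderedOn (r := (· ≤ ·)))
    (PartiallyWellOrderedOn.partiallyWellOrderedOn_sublistForall₂ _
      (isPWO_residualMaps hW))).image_of_monotone_on
      fun _ _ _ hq h ↦ iterate_le_iterate hq.2 h.1 h.2

/-- The residuated pair generated by a set `S` containing `1`: its lower set is the closure of `S`
under `·` and `∧`, and its upper set is the closure of `S` under the residuals by that set. -/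
def generatedPair (S : Set A) (hS : 1 ∈ S) : ResiduatedPair A where
  lower :=
    { carrier := range (MulInfTerm.eval : MulInfTerm S → A)
      one_mem' := ⟨.leaf ⟨1, hS⟩, rfl⟩
      mul_mem' := by
        rintro _ _ ⟨s, rfl⟩ ⟨t, rfl⟩
        exact ⟨.mul s t, rfl⟩ }
  upper := residualClosure (range (MulInfTerm.eval : MulInfTerm S → A)) S
  inf_mem := by
    rintro _ ⟨s, rfl⟩ _ ⟨t, rfl⟩
    exact ⟨.inf s t, rfl⟩
  ldiv_mem w hw _ hr := apply_mem_residualClosure (.inl ⟨w, hw, rfl⟩) hr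
  rdiv_mem w hw _ hr := apply_mem_residualClosure (.inr (.inl ⟨w, hw, rfl⟩)) hr
  himp_mem w hw _ hr := apply_mem_residualClosure (.inr (.inr ⟨w, hw, rfl⟩)) hr

theorem finite_cut_generatedPair {S : Set A} (hS : 1 ∈ S) (hfin : S.Finite) :
    Finite (generatedPair S hS).Cut :=
  finite_cut _ (MulInfTerm.partiallyWellOrderedOn_range_eval hfin)
    (isPWO_residualClosure (MulInfTerm.partiallyWellOrderedOn_range_eval hfin) hfin)

end Residuals

end UA

/-! ### The finite embeddability property -/

open UA UA.ResiduatedPair in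
theorem theorem5p13 : UA.HasFEP UA.HRL.{u} := by
  rintro A _ ⟨_, rfl⟩ B 𝓑 hB hsub
  -- `1` is adjoined so that the lower set is a submonoid even if `1 ∉ B`.
  let P := generatedPair (insert 1 B) (mem_insert 1 B)
  have hl (b : B) : (b : A) ∈ P.lower := ⟨.leaf ⟨b, mem_insert_of_mem _ b.2⟩, rfl⟩
  let ι (b : B) : P.upper := ⟨b, subset_residualClosure _ _ (mem_insert_of_mem _ b.2)⟩
  refine ⟨P.Cut, @HeytingResiduatedLattice.toAlgebra _ P.cutHRL, ⟨P.cutHRL, rfl⟩,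
    finite_cut_generatedPair _ (hB.insert 1), fun b ↦ principal (ι b), ?_, ?_⟩
  · intro b c h
    exact Subtype.ext (congrArg (fun r : P.upper ↦ (r : A)) (principal_injOn (hl b) (hl c) h))
  · intro f p r hr
    have h := hsub f p r hr
    refine Part.mem_some_iff.2 ?_
    replace h := (Part.mem_some_iff.1 h).symm
    cases f with
    | inf => exact principal_inf (r := ι (p (0 : Fin 2))) (s := ι (p (1 : Fin 2))) h
    | sup =>
      exact principal_sup (r := ι (p (0 : Fin 2))) (s := ι (p (1 : Fin 2))) (hl _) (hl _) (hl _) h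
    | mul =>
      exact principal_mul (r := ι (p (0 : Fin 2))) (s := ι (p (1 : Fin 2))) (hl _) (hl _) (hl _) h
    | ldiv => exact principal_ldiv (r := ι (p (0 : Fin 2))) (s := ι (p (1 : Fin 2))) (hl _) h
    | rdiv => exact principal_rdiv (r := ι (p (0 : Fin 2))) (s := ι (p (1 : Fin 2))) (hl _) h
    | imp => exact principal_himp (r := ι (p (0 : Fin 2))) (s := ι (p (1 : Fin 2))) (hl _) h
    | one => exact principal_one (r := ι r) h.symm
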